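/- **Corollary 3.4.** Let $\mathcal C$ be a category with finite colimits, and let $(\mathcal C,+)$ denote $\mathcal C$ with the symmetric monoidal structure given by binary coproducts and the initial object $\varnothing$. A *hypergraph category* is a symmetric monoidal category in which each object $X$ is equipped with a special commutative Frobenius monoid structure $(\mu_X,\delta_X,\eta_X,\epsilon_X)$ such that $\mu_{X\otimes Y}=(\mu_X\otimes\mu_Y)\circ(1\otimes\sigma_{YX}\otimes1)$, $\eta_{X\otimes Y}=\eta_X\otimes\eta_Y$, $\delta_{X\otimes Y}=(1\otimes\sigma_{XY}\otimes1)\circ(\delta_X\otimes\delta_Y)$ and $\epsilon_{X\otimes Y}=\epsilon_X\otimes\epsilon_Y$ (up to the coherence isomorphisms). A *hypergraph functor* $(F,\varphi)$ is a strong symmetric monoidal functor such that the Frobenius structure on each $FX$ is $(F\mu_X\circ\varphi_{X,X},\ \varphi_{X,X}^{-1}\circ F\delta_X,\ F\eta_X\circ\varphi_1,\ \varphi_1^{-1}\circ F\epsilon_X)$. An isomorphism of hypergraph categories is a hypergraph functor with a two-sided inverse hypergraph functor. $\mathrm{Cospan}(\mathcal C)$ is the hypergraph category whose objects are those of $\mathcal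 C$, whose morphisms $X\to Y$ are isomorphism classes of cospans $X\to N\leftarrow Y$, composed by pushout, whose monoidal product is the coproduct, whose coherence isomorphisms are the images of those of $(\mathcal C,+)$ under $f\mapsto(X\xrightarrow{f}Y\xleftarrow{1}Y)$, and whose Frobenius structure on $X$ consists of the copairing $[1_X,1_X]\colon X+X\to X$ and the unique map $\varnothing\to X$, regarded as cospans, together with the opposite cospans. For a lax braided monoidal functor $(F,\varphi)\colon(\mathcal C,+)\to(\mathcal D,\otimes)$ to a braided monoidal category, $F\mathrm{Cospan}$ is the hypergraph category with the same objects, whose morphisms are isomorphism classes of cospans $X\to N\leftarrow Y$ equipped with a *decoration* $s\colon 1\to FN$ (isomorphisms being isomorphisms $n$ of cospans with $Fn\circ s=s'$). Composites are formed by pushout, with decoration $1\xrightarrow{\lambda^{-1}}1\otimes1\xrightarrow{s\otimes t}FN\otimes FM\xrightarrow{\varphi_{N,M}}F(N+M)\to F(N+_YM)$, and monoidal products by coproduct, with decoration $\varphi_{N,N'}\circ(s\otimes t)\circ\lambda^{-1}$. The *empty decoration* on $N$ is $1\xrightarrow{\varphi_1}F\varnothing\to FN$. Identities, coherence isomorphisms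 and Frobenius structures are those of $\mathrm{Cospan}(\mathcal C)$ with empty decorations. Now let $F=1_{\mathcal C}\colon(\mathcal C,+)\to(\mathcal C,+)$ be the identity functor. Then every object $N$ of $\mathcal C$ has exactly one decoration, the empty one, and $\mathrm{Cospan}(\mathcal C)$ and $1_{\mathcal C}\mathrm{Cospan}$ are isomorphic as hypergraph categories, by an isomorphism whose underlying functor is the identity on objects and sends each cospan to the same cospan with the empty decoration. -/

import Mathlib

open CategoryTheory Limits MonoidalCategory

universe v u v₁ u₁ v₂ u₂ v₃ u₃

/-! Throughout, a category with finite colimits is given the monoidal structure `(C, +)`: the monoidal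
product is the binary coproduct, the unit is the initial object and the symmetry is the swap. -/
attribute [local instance] monoidalOfHasFiniteCoproducts symmetricOfHasFiniteCoproducts

namespace Fcospan

/-! ### Hypergraph categories -/

section Hypergraph

/-- A special commutative Frobenius monoid structure on an object `X` of a symmetric monoidal
category: a monoid and a comonoid structure on `X`, commutative and cocommutative, subject to the
Frobenius law and to `μ ∘ δ = 1`. -/
structure SpecialCommFrobenius {H : Type u} [Category.{v} H] [MonoidalCategory H]
    [SymmetricCategory H] (X : H) extends MonObj X, ComonObj X where
  mul_comm : (β_ X X).hom ≫ mul = mul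
  comul_comm : comul ≫ (β_ X X).hom = comul
  frobenius_left : comul ▷ X ≫ (α_ X X X).hom ≫ X ◁ mul = mul ≫ comul
  frobenius_right : X ◁ comul ≫ (α_ X X X).inv ≫ mul ▷ X = mul ≫ comul
  special : comul ≫ mul = 𝟙 X

/-- A hypergraph category: a symmetric monoidal category in which every object is equipped with a
special commutative Frobenius structure, compatibly with the monoidal product.
Here `tensorμ X Y X Y` is `1 ⊗ σ_{Y X} ⊗ 1 : (X ⊗ Y) ⊗ (X ⊗ Y) ⟶ (X ⊗ X) ⊗ (Y ⊗ Y)`. -/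
class HypergraphCategory (H : Type u) [Category.{v} H] [MonoidalCategory H]
    [SymmetricCategory H] where
  frob (X : H) : SpecialCommFrobenius X
  mul_tensor (X Y : H) :
    (frob (X ⊗ Y)).mul = tensorμ X Y X Y ≫ ((frob X).mul ⊗ₘ (frob Y).mul)
  one_tensor (X Y : H) :
    (frob (X ⊗ Y)).one = (λ_ (𝟙_ H)).inv ≫ ((frob X).one ⊗ₘ (frob Y).one)
  comul_tensor (X Y : H) :
    (frob (X ⊗ Y)).comul = ((frob X).comul ⊗ₘ (frob Y).comul) ≫ tensorμ X X Y Y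
  counit_tensor (X Y : H) :
    (frob (X ⊗ Y)).counit = ((frob X).counit ⊗ₘ (frob Y).counit) ≫ (λ_ (𝟙_ H)).hom

open HypergraphCategory Functor.LaxMonoidal Functor.OplaxMonoidal

/-- A hypergraph functor: a strong symmetric monoidal functor carrying the chosen Frobenius
structure of each object `X` to the chosen Frobenius structure of its image. Here `ε`, `μ` are the
coherence maps of the monoidal functor and `η`, `δ` are their inverses. -/
structure HypergraphFunctor (H : Type u₁) [Category.{v₁} H] [MonoidalCategory H]
    [SymmetricCategory H] [HypergraphCategory H] (K : Type u₂) [Category.{v₂} K]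
    [MonoidalCategory K] [SymmetricCategory K] [HypergraphCategory K] extends H ⥤ K where
  braided : toFunctor.Braided
  map_mul (X : H) : (frob (obj X)).mul = μ toFunctor X X ≫ map (frob X).mul
  map_one (X : H) : (frob (obj X)).one = ε toFunctor ≫ map (frob X).one
  map_comul (X : H) : (frob (obj X)).comul = map (frob X).comul ≫ δ toFunctor X X
  map_counit (X : H) : (frob (obj X)).counit = map (frob X).counit ≫ η toFunctor

attribute [instance] HypergraphFunctor.braided

namespace HypergraphFunctor

variable {H : Type u} [Category.{v} H] [MonoidalCategory H]
  [SymmetricCategory H] [HypergraphCategory H] {K : Type u₁} [Category.{v₁} K]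
  [MonoidalCategory K] [SymmetricCategory K] [HypergraphCategory K]
  {L : Type u₂} [Category.{v₂} L]
  [MonoidalCategory L] [SymmetricCategory L] [HypergraphCategory L]
  {M : Type u₃} [Category.{v₃} M]
  [MonoidalCategory M] [SymmetricCategory M] [HypergraphCategory M]

/-- The identity hypergraph functor. -/
def id (H : Type u) [Category.{v} H] [MonoidalCategory H]
    [SymmetricCategory H] [HypergraphCategory H] : HypergraphFunctor H H where
  toFunctor := 𝟭 H
  braided := inferInstance
  map_mul X := by simp
  map_one X := by simp
  map_comul X := by simp
  map_counit X := by simp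

/-- The composite of two hypergraph functors, with the usual coherence maps. -/
def comp (S : HypergraphFunctor H K) (T : HypergraphFunctor K L) : HypergraphFunctor H L where
  toFunctor := S.toFunctor ⋙ T.toFunctor
  braided := inferInstance
  map_mul X := by simp [map_mul]
  map_one X := by simp [map_one]
  map_comul X := by simp [map_comul]
  map_counit X := by simp [map_counit]

lemma mk_congr (S : H ⥤ K) (b b' : S.Braided) (h₁ h₂ h₃ h₄ h₁' h₂' h₃' h₄')
    (hε : b.ε = b'.ε) (hμ : b.μ = b'.μ) :
    (⟨S, b, h₁, h₂, h₃, h₄⟩ : HypergraphFunctor H K) = ⟨S, b', h₁', h₂', h₃', h₄'⟩ := by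
  have : b = b' := by
    have h : b.toMonoidal = b'.toMonoidal :=
      Functor.Monoidal.toLaxMonoidal_injective _ (Functor.LaxMonoidal.ext hε hμ)
    cases b; cases b'; cases h; rfl
  subst this; rfl

lemma id_comp (S : HypergraphFunctor H K) : (id H).comp S = S := by
  obtain ⟨S, b, _, _, _, _⟩ := S
  refine mk_congr S _ b _ _ _ _ _ _ _ _ ?_ ?_
  · change ε S ≫ S.map (𝟙 _) = ε S
    simp
  · funext X Y
    change μ S X Y ≫ S.map (𝟙 _) = μ S X Y
    simp

lemma comp_id (S : HypergraphFunctor H K) : S.comp (id K) = S := by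
  obtain ⟨S, b, _, _, _, _⟩ := S
  refine mk_congr S _ b _ _ _ _ _ _ _ _ ?_ ?_
  · change 𝟙 _ ≫ ε S = ε S
    simp
  · funext X Y
    change 𝟙 _ ≫ μ S X Y = μ S X Y
    simp

lemma comp_assoc (S : HypergraphFunctor H K) (T : HypergraphFunctor K L)
    (U : HypergraphFunctor L M) : (S.comp T).comp U = S.comp (T.comp U) := by
  obtain ⟨S, _, _, _, _, _⟩ := S
  obtain ⟨T, _, _, _, _, _⟩ := T
  obtain ⟨U, _, _, _, _, _⟩ := U
  refine mk_congr (S ⋙ T ⋙ U) _ _ _ _ _ _ _ _ _ _ ?_ ?_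
  · change ε U ≫ U.map (ε T ≫ T.map (ε S)) = (ε U ≫ U.map (ε T)) ≫ U.map (T.map (ε S))
    simp
  · funext X Y
    change μ U _ _ ≫ U.map (μ T _ _ ≫ T.map (μ S X Y)) =
      (μ U _ _ ≫ U.map (μ T _ _)) ≫ U.map (T.map (μ S X Y))
    simp

end HypergraphFunctor

/-- Bundled hypergraph categories. -/
structure HypergraphCat : Type (max (u + 1) (v + 1)) where
  carrier : Type u
  [category : Category.{v} carrier]
  [monoidal : MonoidalCategory carrier]
  [symmetric : SymmetricCategory carrier]
  [hypergraph : HypergraphCategory carrier]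

attribute [instance] HypergraphCat.category HypergraphCat.monoidal HypergraphCat.symmetric
  HypergraphCat.hypergraph

/-- The category of hypergraph categories and hypergraph functors. An isomorphism in this category
is an isomorphism of hypergraph categories. -/
instance : Category HypergraphCat.{v, u} where
  Hom H K := HypergraphFunctor H.carrier K.carrier
  id H := HypergraphFunctor.id H.carrier
  comp S T := S.comp T
  id_comp := HypergraphFunctor.id_comp
  comp_id := HypergraphFunctor.comp_id
  assoc := HypergraphFunctor.comp_assoc

end Hypergraph

/-! ### Decorations -/

attribute [local simp] coprod.inl_desc coprod.inr_desc coprod.inl_desc_assoc coprod.inr_desc_assoc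
  coprod.inl_map coprod.inr_map coprod.inl_map_assoc coprod.inr_map_assoc

section Decorations

open Functor.LaxMonoidal

variable {C : Type u} [Category.{v} C] {D : Type u₁} [Category.{v₁} D] [MonoidalCategory D]

/-- The elements `1 ⟶ F N`, i.e. the possible decorations of a cospan with apex `N`. -/
abbrev Decoration (F : C ⥤ D) (N : C) : Type v₁ := 𝟙_ D ⟶ F.obj N

namespace Decoration

/-- The image of a decoration under a morphism of apices. -/
def push {F : C ⥤ D} {N M : C} (f : N ⟶ M) (s : Decoration F N) : Decoration F M :=
  s ≫ F.map f

@[simp] lemma push_id {F : C ⥤ D} {N : C} (s : Decoration F N) : push (𝟙 N) s = s := by simp [push]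

@[simp] lemma push_push {F : C ⥤ D} {N M P : C} (f : N ⟶ M) (g : M ⟶ P) (s : Decoration F N) :
    push g (push f s) = push (f ≫ g) s := by simp [push]

variable [HasFiniteColimits C] (F : C ⥤ D) [F.LaxMonoidal]

/-- The empty decoration `1 ⟶ F ∅ ⟶ F N`. -/
noncomputable def empty (N : C) : Decoration F N := ε F ≫ F.map (initial.to N)

variable {F}

/-- The composite `1 ⟶ 1 ⊗ 1 ⟶ F N ⊗ F M ⟶ F (N + M)`. -/
noncomputable def tensor {N M : C} (s : Decoration F N) (t : Decoration F M) :
    Decoration F (N ⨿ M) :=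
  (λ_ (𝟙_ D)).inv ≫ (s ⊗ₘ t) ≫ μ F N M

/-- The empty decoration is the unit of the product below. -/
noncomputable instance (N : C) : One (Decoration F N) := ⟨empty F N⟩

/-- Decorations of a fixed apex multiply by `tensor` followed by the fold map. This auxiliary
product is used only to compute with `tensor`, see `push_desc_tensor`. -/
noncomputable instance (N : C) : Mul (Decoration F N) :=
  ⟨fun s t ↦ push (coprod.desc (𝟙 N) (𝟙 N)) (tensor s t)⟩

lemma one_def (N : C) : (1 : Decoration F N) = ε F ≫ F.map (initial.to N) := rfl

lemma mul_def {N : C} (s t : Decoration F N) : s * t = push (coprod.desc (𝟙 N) (𝟙 N)) (tensor s t) :=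
  rfl

lemma empty_eq (N : C) : empty F N = 1 := rfl

@[simp] lemma push_one {N M : C} (f : N ⟶ M) : push f (1 : Decoration F N) = 1 := by
  simp only [push, one_def, Category.assoc, ← F.map_comp]
  congr 2
  exact initialIsInitial.hom_ext _ _

lemma tensor_push {N M N' M' : C} (f : N ⟶ N') (g : M ⟶ M') (s : Decoration F N)
    (t : Decoration F M) : tensor (push f s) (push g t) = push (coprod.map f g) (tensor s t) := by
  have h := μ_natural F f g
  simp only [tensor, push, Category.assoc, ← tensorHom_comp_tensorHom]
  rw [h]
  rfl

lemma push_desc_tensor {N M P : C} (f : N ⟶ P) (g : M ⟶ P) (s : Decoration F N)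
    (t : Decoration F M) : push (coprod.desc f g) (tensor s t) = push f s * push g t := by
  rw [mul_def, tensor_push, push_push]
  simp

@[simp] lemma push_mul {N M : C} (f : N ⟶ M) (s t : Decoration F N) :
    push f (s * t) = push f s * push f t := by
  rw [mul_def, push_push, ← push_desc_tensor]
  simp

lemma tensor_eq {N M : C} (s : Decoration F N) (t : Decoration F M) :
    tensor s t = push coprod.inl s * push coprod.inr t := by
  rw [← push_desc_tensor]
  simp

lemma tensor_unit {N : C} (s : Decoration F N) :
    push (ρ_ N).hom (tensor s (ε F : Decoration F (𝟙_ C))) = s := by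
  have h : (s ⊗ₘ ε F) ≫ μ F N (𝟙_ C) ≫ F.map (ρ_ N).hom = s ▷ 𝟙_ D ≫ (ρ_ (F.obj N)).hom := by
    rw [right_unitality F N, MonoidalCategory.tensorHom_def, Category.assoc]
  have h' : push (ρ_ N).hom (tensor s (ε F : Decoration F (𝟙_ C))) =
      (λ_ (𝟙_ D)).inv ≫ (s ⊗ₘ ε F) ≫ μ F N (𝟙_ C) ≫ F.map (ρ_ N).hom := by
    simp only [push, tensor, Category.assoc]
  rw [h', h, rightUnitor_naturality, ← unitors_equal]
  simp

lemma unit_tensor {N : C} (s : Decoration F N) :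
    push (λ_ N).hom (tensor (ε F : Decoration F (𝟙_ C)) s) = s := by
  have h : (ε F ⊗ₘ s) ≫ μ F (𝟙_ C) N ≫ F.map (λ_ N).hom = 𝟙_ D ◁ s ≫ (λ_ (F.obj N)).hom := by
    rw [left_unitality F N, MonoidalCategory.tensorHom_def', Category.assoc]
  have h' : push (λ_ N).hom (tensor (ε F : Decoration F (𝟙_ C)) s) =
      (λ_ (𝟙_ D)).inv ≫ (ε F ⊗ₘ s) ≫ μ F (𝟙_ C) N ≫ F.map (λ_ N).hom := by
    simp only [push, tensor, Category.assoc]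
  rw [h', h, leftUnitor_naturality]
  simp

lemma tensor_assoc {N M P : C} (s : Decoration F N) (t : Decoration F M) (r : Decoration F P) :
    push (coprod.associator N M P).hom (tensor (tensor s t) r) = tensor s (tensor t r) := by
  have h : μ F N M ▷ F.obj P ≫ μ F (N ⨿ M) P ≫ F.map (coprod.associator N M P).hom =
    (α_ (F.obj N) (F.obj M) (F.obj P)).hom ≫ F.obj N ◁ μ F M P ≫ μ F N (M ⨿ P) :=
    associativity F N M P
  have e : ∀ {A B E G : D} (s : 𝟙_ D ⟶ A) (t : 𝟙_ D ⟶ B) (r : 𝟙_ D ⟶ E) (m : A ⊗ B ⟶ G),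
      (λ_ (𝟙_ D)).inv ≫ (((λ_ (𝟙_ D)).inv ≫ (s ⊗ₘ t) ≫ m) ⊗ₘ r) =
        (λ_ (𝟙_ D)).inv ≫ (λ_ (𝟙_ D)).inv ▷ 𝟙_ D ≫ ((s ⊗ₘ t) ⊗ₘ r) ≫ m ▷ E := by
    intro A B E G s t r m
    congr 1
    rw [← MonoidalCategory.tensorHom_id, ← MonoidalCategory.tensorHom_id,
      MonoidalCategory.tensorHom_comp_tensorHom, MonoidalCategory.tensorHom_comp_tensorHom]
    simp
  have e' : ∀ {A B E G : D} (s : 𝟙_ D ⟶ A) (t : 𝟙_ D ⟶ B) (r : 𝟙_ D ⟶ E) (m : B ⊗ E ⟶ G),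
      (λ_ (𝟙_ D)).inv ≫ (s ⊗ₘ ((λ_ (𝟙_ D)).inv ≫ (t ⊗ₘ r) ≫ m)) =
        (λ_ (𝟙_ D)).inv ≫ 𝟙_ D ◁ (λ_ (𝟙_ D)).inv ≫ (s ⊗ₘ (t ⊗ₘ r)) ≫ A ◁ m := by
    intro A B E G s t r m
    congr 1
    rw [← MonoidalCategory.id_tensorHom, ← MonoidalCategory.id_tensorHom,
      MonoidalCategory.tensorHom_comp_tensorHom, MonoidalCategory.tensorHom_comp_tensorHom]
    simp
  have e₂ := e s t r (μ F N M) =≫ (μ F (N ⨿ M) P ≫ F.map (coprod.associator N M P).hom)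
  have e₃ := e' s t r (μ F M P) =≫ μ F N (M ⨿ P)
  simp only [Category.assoc] at e₂ e₃
  have h1 : push (coprod.associator N M P).hom (tensor (tensor s t) r) =
      (λ_ (𝟙_ D)).inv ≫ (((λ_ (𝟙_ D)).inv ≫ (s ⊗ₘ t) ≫ μ F N M) ⊗ₘ r) ≫
        μ F (N ⨿ M) P ≫ F.map (coprod.associator N M P).hom := by
    simp only [push, tensor, Category.assoc]
  have h2 : tensor s (tensor t r) =
      (λ_ (𝟙_ D)).inv ≫ (s ⊗ₘ ((λ_ (𝟙_ D)).inv ≫ (t ⊗ₘ r) ≫ μ F M P)) ≫ μ F N (M ⨿ P) := rfl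
  rw [h1, h2, e₂, e₃, h, MonoidalCategory.associator_naturality_assoc]
  congr 1
  have : (λ_ (𝟙_ D)).inv ▷ 𝟙_ D ≫ (α_ (𝟙_ D) (𝟙_ D) (𝟙_ D)).hom = 𝟙_ D ◁ (λ_ (𝟙_ D)).inv := by
    rw [unitors_inv_equal]
    simp
  rw [reassoc_of% this]

lemma mul_one' {N : C} (s : Decoration F N) : s * 1 = s := by
  have h := push_desc_tensor (𝟙 N) (initial.to N) s (ε F : Decoration F (𝟙_ C))
  rw [push_id] at h
  exact h.symm.trans (tensor_unit s)

lemma one_mul' {N : C} (s : Decoration F N) : 1 * s = s := by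
  have h := push_desc_tensor (initial.to N) (𝟙 N) (ε F : Decoration F (𝟙_ C)) s
  rw [push_id] at h
  exact h.symm.trans (unit_tensor s)

lemma mul_assoc' {N : C} (s t r : Decoration F N) : s * t * r = s * (t * r) := by
  have h := congrArg (push (coprod.desc (𝟙 N) (coprod.desc (𝟙 N) (𝟙 N)))) (tensor_assoc s t r)
  rw [push_desc_tensor, push_desc_tensor, push_push] at h
  have h2 : (coprod.associator N N N).hom ≫ coprod.desc (𝟙 N) (coprod.desc (𝟙 N) (𝟙 N)) =
      coprod.desc (coprod.desc (𝟙 N) (𝟙 N)) (𝟙 N) := by ext <;> simp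
  rw [h2, push_desc_tensor, push_desc_tensor] at h
  simpa using h

noncomputable instance (N : C) : Monoid (Decoration F N) where
  mul_one := mul_one'
  one_mul := one_mul'
  mul_assoc := mul_assoc'

end Decoration

lemma Decoration.mul_comm' [HasFiniteColimits C] [BraidedCategory D] {F : C ⥤ D} [F.LaxBraided]
    {N : C} (s t : Decoration F N) : s * t = t * s := by
  have h : μ F N N ≫ F.map (coprod.braiding N N).hom = (β_ (F.obj N) (F.obj N)).hom ≫ μ F N N :=
    Functor.LaxBraided.braided (F := F) N N
  have h3 : push (coprod.braiding N N).hom (tensor s t) = tensor t s := by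
    have h' : push (coprod.braiding N N).hom (tensor s t) =
      (λ_ (𝟙_ D)).inv ≫ (s ⊗ₘ t) ≫ μ F N N ≫ F.map (coprod.braiding N N).hom := by
      simp only [push, tensor, Category.assoc]
    have h2 := BraidedCategory.braiding_naturality s t
    rw [h', h, reassoc_of% h2, braiding_tensorUnit_left]
    simp [tensor, ← unitors_inv_equal]
  rw [mul_def, mul_def, ← h3, push_push]
  congr 1
  ext <;> simp

end Decorations

/-! ### Cospans and decorated cospans -/

section Cospans

variable {C : Type u} [Category.{v} C]

/-- A cospan `X ⟶ apex ⟵ Y`, with legs `i` and `o`. -/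
structure Cospan (X Y : C) where
  apex : C
  i : X ⟶ apex
  o : Y ⟶ apex

namespace Cospan

/-- Isomorphism of cospans with the same feet. -/
def IsIsomorphic {X Y : C} (c c' : Cospan X Y) : Prop :=
  ∃ n : c.apex ≅ c'.apex, c.i ≫ n.hom = c'.i ∧ c.o ≫ n.hom = c'.o

instance setoid (X Y : C) : Setoid (Cospan X Y) where
  r := IsIsomorphic
  iseqv :=
    { refl := fun c ↦ ⟨Iso.refl _, by simp⟩
      symm := fun ⟨n, h, h'⟩ ↦ ⟨n.symm, by simp [← h, ← h']⟩
      trans := fun ⟨n, h, h'⟩ ⟨m, k, k'⟩ ↦ ⟨n ≪≫ m, by simp [← h, ← h', ← k, ← k']⟩ }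

/-- The identity cospan. -/
def id (X : C) : Cospan X X := ⟨X, 𝟙 X, 𝟙 X⟩

variable [HasFiniteColimits C]

/-- The composite of two cospans, by pushout over the common foot. -/
noncomputable def comp {X Y Z : C} (c : Cospan X Y) (d : Cospan Y Z) : Cospan X Z where
  apex := pushout c.o d.i
  i := c.i ≫ pushout.inl c.o d.i
  o := d.o ≫ pushout.inr c.o d.i

/-- The coproduct of two cospans. -/
noncomputable def tensor {X Y X' Y' : C} (c : Cospan X Y) (d : Cospan X' Y') :
    Cospan (X ⨿ X') (Y ⨿ Y') where
  apex := c.apex ⨿ d.apex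
  i := coprod.map c.i d.i
  o := coprod.map c.o d.o

end Cospan

variable {D : Type u₁} [Category.{v₁} D] [MonoidalCategory D]

/-- An `F`-decorated cospan: a cospan together with an element `1 ⟶ F N` of the image of its
apex `N`. -/
structure DecoratedCospan (F : C ⥤ D) (X Y : C) extends Cospan X Y where
  dec : Decoration F apex

namespace DecoratedCospan

variable {F : C ⥤ D}

/-- Isomorphism of decorated cospans: an isomorphism of cospans preserving the decoration. -/
def IsIsomorphic {X Y : C} (c c' : DecoratedCospan F X Y) : Prop :=
  ∃ n : c.apex ≅ c'.apex, c.i ≫ n.hom = c'.i ∧ c.o ≫ n.hom = c'.o ∧ c.dec ≫ F.map n.hom = c'.dec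

instance setoid (F : C ⥤ D) (X Y : C) : Setoid (DecoratedCospan F X Y) where
  r := IsIsomorphic
  iseqv :=
    { refl := fun c ↦ ⟨Iso.refl _, by simp⟩
      symm := fun ⟨n, h, h', h''⟩ ↦ ⟨n.symm, by simp [← h, ← h', ← h'', ← F.map_comp]⟩
      trans := fun ⟨n, h, h', h''⟩ ⟨m, k, k', k''⟩ ↦
        ⟨n ≪≫ m, by simp [← h, ← h', ← k, ← k', ← h'', ← k'']⟩ }

variable [HasFiniteColimits C] [F.LaxMonoidal]

/-- A cospan with the empty decoration on its apex. -/
noncomputable def ofCospan (F : C ⥤ D) [F.LaxMonoidal] {X Y : C} (c : Cospan X Y) :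
    DecoratedCospan F X Y where
  toCospan := c
  dec := Decoration.empty F c.apex

/-- The composite of two decorated cospans: the composite cospan, decorated by
`1 ⟶ 1 ⊗ 1 ⟶ F N ⊗ F M ⟶ F (N + M) ⟶ F (N +_Y M)`. -/
noncomputable def comp {X Y Z : C} (c : DecoratedCospan F X Y) (d : DecoratedCospan F Y Z) :
    DecoratedCospan F X Z where
  toCospan := c.toCospan.comp d.toCospan
  dec := c.dec.tensor d.dec ≫ F.map (coprod.desc (pushout.inl c.o d.i) (pushout.inr c.o d.i))

/-- The monoidal product of two decorated cospans: the coproduct cospan, decorated by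
`1 ⟶ 1 ⊗ 1 ⟶ F N ⊗ F N' ⟶ F (N + N')`. -/
noncomputable def tensor {X Y X' Y' : C} (c : DecoratedCospan F X Y)
    (d : DecoratedCospan F X' Y') : DecoratedCospan F (X ⨿ X') (Y ⨿ Y') where
  toCospan := c.toCospan.tensor d.toCospan
  dec := c.dec.tensor d.dec

/-! Composites may be computed with an arbitrary pushout. -/

open Decoration

lemma comp_equiv {X Y Z : C} (c : DecoratedCospan F X Y) (d : DecoratedCospan F Y Z)
    {P : C} {j : c.apex ⟶ P} {k : d.apex ⟶ P} (h : IsPushout c.o d.i j k) :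
    c.comp d ≈ ⟨⟨P, c.i ≫ j, d.o ≫ k⟩, push j c.dec * push k d.dec⟩ := by
  have h0 := IsPushout.of_hasPushout c.o d.i
  refine ⟨h0.isoIsPushout _ _ h, ?_, ?_, ?_⟩
  · simp [comp, Cospan.comp]
  · simp [comp, Cospan.comp]
  · have e : push (h0.isoIsPushout _ _ h).hom
        (push (coprod.desc (pushout.inl c.o d.i) (pushout.inr c.o d.i)) (c.dec.tensor d.dec)) =
        push j c.dec * push k d.dec := by
      rw [push_desc_tensor]
      simp
    exact e

lemma comp_congr {X Y Z : C} {c c' : DecoratedCospan F X Y} {d d' : DecoratedCospan F Y Z}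
    (h : c ≈ c') (k : d ≈ d') : c.comp d ≈ c'.comp d' := by
  obtain ⟨n, h₁, h₂, h₃⟩ := h
  obtain ⟨m, k₁, k₂, k₃⟩ := k
  have h0 := IsPushout.of_hasPushout c'.o d'.i
  have h1 : IsPushout c.o d.i (n.hom ≫ pushout.inl c'.o d'.i) (m.hom ≫ pushout.inr c'.o d'.i) :=
    h0.of_iso (Iso.refl _) n.symm m.symm (Iso.refl _) (by simp [← h₂]) (by simp [← k₁])
      (by simp) (by simp)
  refine Setoid.trans (comp_equiv c d h1) (Setoid.trans ?_ (Setoid.symm (comp_equiv c' d' h0)))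
  refine ⟨Iso.refl _, by simp [← h₁], by simp [← k₂], ?_⟩
  change push (𝟙 _) (push _ c.dec * push _ d.dec) = _
  rw [push_id, ← h₃, ← k₃]
  simp [push]

lemma tensor_congr {X Y X' Y' : C} {c c' : DecoratedCospan F X Y} {d d' : DecoratedCospan F X' Y'}
    (h : c ≈ c') (k : d ≈ d') : c.tensor d ≈ c'.tensor d' := by
  obtain ⟨n, h₁, h₂, h₃⟩ := h
  obtain ⟨m, k₁, k₂, k₃⟩ := k
  refine ⟨coprod.mapIso n m, ?_, ?_, ?_⟩
  · simp [tensor, Cospan.tensor, h₁, k₁]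
  · simp [tensor, Cospan.tensor, h₂, k₂]
  · have e : push (coprod.map n.hom m.hom) (c.dec.tensor d.dec) = c'.dec.tensor d'.dec := by
      rw [← tensor_push, ← h₃, ← k₃]
      rfl
    exact e

end DecoratedCospan

end Cospans

/-! ### The category of decorated cospans -/

section DecCospanCat

variable {C : Type u} [Category.{v} C] {D : Type u₁} [Category.{v₁} D] [MonoidalCategory D]

/-- The category `F Cospan` of `F`-decorated cospans, for `F` a lax braided monoidal functor
`(C, +) ⥤ (D, ⊗)`. Its objects are the objects of `C`. -/
structure DecCospanCat (F : C ⥤ D) where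
  as : C

namespace DecCospanCat

variable [HasFiniteColimits C] [BraidedCategory D] {F : C ⥤ D} [F.LaxBraided]

/-- Morphisms of `F Cospan` are isomorphism classes of decorated cospans. -/
noncomputable instance : CategoryStruct.{max u v v₁} (DecCospanCat F) where
  Hom X Y := Quotient (DecoratedCospan.setoid F X.as Y.as)
  id X := Quotient.mk _ (.ofCospan F (.id X.as))
  comp := Quotient.map₂ DecoratedCospan.comp fun _ _ h _ _ k ↦ DecoratedCospan.comp_congr h k

open Decoration

/-- The class of a decorated cospan. -/
def homMk {X Y : DecCospanCat F} (N : C) (i : X.as ⟶ N) (o : Y.as ⟶ N) (s : Decoration F N) :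
    X ⟶ Y := Quotient.mk _ ⟨⟨N, i, o⟩, s⟩

lemma exists_homMk {X Y : DecCospanCat F} (f : X ⟶ Y) : ∃ N i o s, f = homMk N i o s := by
  induction f using Quotient.ind with
  | _ c => exact ⟨c.apex, c.i, c.o, c.dec, rfl⟩

lemma homMk_congr {X Y : DecCospanCat F} {N N' : C} {i : X.as ⟶ N} {o : Y.as ⟶ N}
    {s : Decoration F N} {i' : X.as ⟶ N'} {o' : Y.as ⟶ N'} {s' : Decoration F N'} (n : N ≅ N')
    (hi : i ≫ n.hom = i') (ho : o ≫ n.hom = o') (hs : push n.hom s = s') :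
    homMk N i o s = homMk N' i' o' s' :=
  Quotient.sound ⟨n, hi, ho, hs⟩

lemma homMk_comp {X Y Z : DecCospanCat F} {N M P : C} {i : X.as ⟶ N} {o : Y.as ⟶ N}
    {s : Decoration F N} {i' : Y.as ⟶ M} {o' : Z.as ⟶ M} {t : Decoration F M} {j : N ⟶ P}
    {k : M ⟶ P} (h : IsPushout o i' j k) :
    homMk N i o s ≫ homMk M i' o' t = homMk P (i ≫ j) (o' ≫ k) (push j s * push k t) :=
  Quotient.sound (DecoratedCospan.comp_equiv ⟨⟨N, i, o⟩, s⟩ ⟨⟨M, i', o'⟩, t⟩ h)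

lemma id_eq (X : DecCospanCat F) : 𝟙 X = homMk X.as (𝟙 _) (𝟙 _) 1 := rfl

noncomputable instance : Category.{max u v v₁} (DecCospanCat F) where
  id_comp f := by
    obtain ⟨N, i, o, s, rfl⟩ := exists_homMk f
    rw [id_eq, homMk_comp (IsPushout.of_id_fst)]
    simp
  comp_id f := by
    obtain ⟨N, i, o, s, rfl⟩ := exists_homMk f
    rw [id_eq, homMk_comp (IsPushout.of_id_snd)]
    simp
  assoc f g h := by
    obtain ⟨N, i, o, s, rfl⟩ := exists_homMk f
    obtain ⟨M, i', o', t, rfl⟩ := exists_homMk g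
    obtain ⟨P, i'', o'', r, rfl⟩ := exists_homMk h
    have h1 := IsPushout.of_hasPushout o i'
    have h2 := IsPushout.of_hasPushout o' i''
    have h3 := IsPushout.of_hasPushout (pushout.inr o i') (pushout.inl o' i'')
    rw [homMk_comp h1, homMk_comp h2, homMk_comp (h2.paste_horiz h3),
      homMk_comp (h1.paste_vert h3)]
    simp [mul_assoc, h3.w]

/-- The wide embedding of `C`, sending `f : X ⟶ Y` to the cospan `X ⟶ Y ⟵ Y` with legs `f` and
`1`, empty-decorated. -/
noncomputable def gr {X Y : DecCospanCat F} (f : X.as ⟶ Y.as) : X ⟶ Y :=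
  Quotient.mk _ (.ofCospan F ⟨Y.as, f, 𝟙 _⟩)

/-- The opposite of `gr f`. -/
noncomputable def opGr {X Y : DecCospanCat F} (f : X.as ⟶ Y.as) : Y ⟶ X :=
  Quotient.mk _ (.ofCospan F ⟨Y.as, 𝟙 _, f⟩)

lemma gr_eq {X Y : DecCospanCat F} (f : X.as ⟶ Y.as) : gr f = homMk Y.as f (𝟙 _) 1 := rfl

lemma opGr_eq {X Y : DecCospanCat F} (f : X.as ⟶ Y.as) : opGr f = homMk Y.as (𝟙 _) f 1 := rfl

lemma gr_comp_homMk {X Y Z : DecCospanCat F} (f : X.as ⟶ Y.as) {N : C} (i : Y.as ⟶ N)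
    (o : Z.as ⟶ N) (s : Decoration F N) : gr f ≫ homMk N i o s = homMk N (f ≫ i) o s := by
  rw [gr_eq, homMk_comp (IsPushout.of_id_fst)]
  simp

lemma homMk_comp_opGr {X Y Z : DecCospanCat F} (f : Z.as ⟶ Y.as) {N : C} (i : X.as ⟶ N)
    (o : Y.as ⟶ N) (s : Decoration F N) : homMk N i o s ≫ opGr f = homMk N i (f ≫ o) s := by
  rw [opGr_eq, homMk_comp (IsPushout.of_id_snd)]
  simp

lemma homMk_comp_gr_iso {X Y Z : DecCospanCat F} (e : Y.as ≅ Z.as) {N : C} (i : X.as ⟶ N)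
    (o : Y.as ⟶ N) (s : Decoration F N) :
    homMk N i o s ≫ gr e.hom = homMk N i (e.inv ≫ o) s := by
  rw [gr_eq, homMk_comp (j := 𝟙 _) (k := e.inv ≫ o) (IsPushout.of_vert_isIso ⟨by simp⟩)]
  simp

lemma gr_comp_opGr {X Y Z : DecCospanCat F} (f : X.as ⟶ Y.as) (g : Z.as ⟶ Y.as) :
    gr f ≫ opGr g = homMk Y.as f g 1 := by
  rw [opGr_eq, gr_comp_homMk]
  simp

lemma opGr_comp_gr {X Y Z : DecCospanCat F} {f : X.as ⟶ Y.as} {g : X.as ⟶ Z.as} {P : C}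
    {j : Y.as ⟶ P} {k : Z.as ⟶ P} (h : IsPushout f g j k) :
    opGr f ≫ gr g = homMk P j k 1 := by
  rw [opGr_eq, gr_eq, homMk_comp h]
  simp

lemma gr_id (X : DecCospanCat F) : gr (𝟙 X.as) = 𝟙 X := rfl

lemma opGr_id (X : DecCospanCat F) : opGr (𝟙 X.as) = 𝟙 X := rfl

lemma gr_comp {X Y Z : DecCospanCat F} (f : X.as ⟶ Y.as) (g : Y.as ⟶ Z.as) :
    gr f ≫ gr g = gr (f ≫ g) := by
  rw [gr_eq g, gr_comp_homMk, gr_eq]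

lemma opGr_comp {X Y Z : DecCospanCat F} (f : X.as ⟶ Y.as) (g : Y.as ⟶ Z.as) :
    opGr g ≫ opGr f = opGr (f ≫ g) := by
  rw [opGr_eq g, homMk_comp_opGr, opGr_eq]

lemma opGr_iso_hom {X Y : DecCospanCat F} (e : X.as ≅ Y.as) : opGr e.hom = gr e.inv :=
  homMk_congr e.symm (by simp) (by simp) (push_one _)

/-- An isomorphism of `C`, regarded as an isomorphism of `F Cospan`. -/
@[simps]
noncomputable def grIso {X Y : DecCospanCat F} (e : X.as ≅ Y.as) : X ≅ Y where
  hom := gr e.hom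
  inv := gr e.inv
  hom_inv_id := by rw [gr_comp, e.hom_inv_id, gr_id]
  inv_hom_id := by rw [gr_comp, e.inv_hom_id, gr_id]

end DecCospanCat

end DecCospanCat

/-! ### The monoidal and hypergraph structure of `F Cospan` -/

section Monoidal

variable {C : Type u} [Category.{v} C]

lemma isPushout_mk {X Y Z P : C} {f : X ⟶ Y} {g : X ⟶ Z} {j : Y ⟶ P} {k : Z ⟶ P}
    (w : f ≫ j = g ≫ k)
    (h : ∀ (Q : C) (a : Y ⟶ Q) (b : Z ⟶ Q), f ≫ a = g ≫ b → ∃ l : P ⟶ Q, j ≫ l = a ∧ k ≫ l = b)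
    (h' : ∀ (Q : C) (l l' : P ⟶ Q), j ≫ l = j ≫ l' → k ≫ l = k ≫ l' → l = l') :
    IsPushout f g j k := by
  choose d h₁ h₂ using h
  refine ⟨⟨w⟩, ⟨PushoutCocone.IsColimit.mk w (fun s ↦ d _ s.inl s.inr s.condition)
    (fun s ↦ h₁ _ _ _ _) (fun s ↦ h₂ _ _ _ _) fun s m hm hm' ↦ h' _ _ _ ?_ ?_⟩⟩
  · rw [hm, h₁]
  · rw [hm', h₂]

variable [HasFiniteColimits C] {D : Type u₁} [Category.{v₁} D] [MonoidalCategory D]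

lemma isPushout_coprod {X Y Z P X' Y' Z' P' : C} {f : X ⟶ Y} {g : X ⟶ Z} {j : Y ⟶ P} {k : Z ⟶ P}
    {f' : X' ⟶ Y'} {g' : X' ⟶ Z'} {j' : Y' ⟶ P'} {k' : Z' ⟶ P'}
    (h : IsPushout f g j k) (h' : IsPushout f' g' j' k') :
    IsPushout (coprod.map f f') (coprod.map g g') (coprod.map j j') (coprod.map k k') := by
  refine isPushout_mk (by simp [h.w, h'.w]) (fun Q a b e ↦ ?_) (fun Q l l' e₁ e₂ ↦ ?_)
  · refine ⟨coprod.desc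
      (h.desc (coprod.inl ≫ a) (coprod.inl ≫ b) (by simpa using coprod.inl ≫= e))
      (h'.desc (coprod.inr ≫ a) (coprod.inr ≫ b) (by simpa using coprod.inr ≫= e)), ?_, ?_⟩ <;>
    ext <;> simp
  · ext
    · exact h.hom_ext (by simpa using coprod.inl ≫= e₁) (by simpa using coprod.inl ≫= e₂)
    · exact h'.hom_ext (by simpa using coprod.inr ≫= e₁) (by simpa using coprod.inr ≫= e₂)

/-- The interchange of the two middle summands. -/
noncomputable def swap (X Y Z W : C) : (X ⨿ Y) ⨿ (Z ⨿ W) ⟶ (X ⨿ Z) ⨿ (Y ⨿ W) :=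
  coprod.desc (coprod.map coprod.inl coprod.inl) (coprod.map coprod.inr coprod.inr)

/-- `swap` as an isomorphism. -/
@[simps]
noncomputable def swapIso (X Y Z W : C) : (X ⨿ Y) ⨿ (Z ⨿ W) ≅ (X ⨿ Z) ⨿ (Y ⨿ W) where
  hom := swap X Y Z W
  inv := swap X Z Y W
  hom_inv_id := by ext <;> simp [swap]
  inv_hom_id := by ext <;> simp [swap]

lemma swap_eq (X Y Z W : C) : (coprod.associator X Y (Z ⨿ W)).hom ≫
    coprod.map (𝟙 X) (coprod.associator Y Z W).inv ≫
      coprod.map (𝟙 X) (coprod.map (coprod.braiding Y Z).hom (𝟙 W)) ≫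
        coprod.map (𝟙 X) (coprod.associator Z Y W).hom ≫
          (coprod.associator X Z (Y ⨿ W)).inv = swap X Y Z W := by
  ext <;> simp [swap]

lemma map_braiding {X Y X' Y' : C} (f : X ⟶ Y) (g : X' ⟶ Y') :
    coprod.map f g ≫ (coprod.braiding Y Y').hom = (coprod.braiding X X').hom ≫ coprod.map g f := by
  ext <;> simp

/-- The fold map `[1, 1] : X + X ⟶ X`. -/
noncomputable def fold (X : C) : X ⨿ X ⟶ X := coprod.desc (𝟙 X) (𝟙 X)

lemma unit_fold (X : C) : coprod.map (initial.to X) (𝟙 X) ≫ fold X = (coprod.leftUnitor X).hom := by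
  ext <;> simp [fold]

lemma fold_unit (X : C) :
    coprod.map (𝟙 X) (initial.to X) ≫ fold X = (coprod.rightUnitor X).hom := by
  ext <;> simp [fold]

lemma fold_assoc (X : C) : coprod.map (fold X) (𝟙 X) ≫ fold X =
    (coprod.associator X X X).hom ≫ coprod.map (𝟙 X) (fold X) ≫ fold X := by
  ext <;> simp [fold]

lemma fold_assoc_inv (X : C) : (coprod.associator X X X).inv ≫ coprod.map (fold X) (𝟙 X) ≫ fold X =
    coprod.map (𝟙 X) (fold X) ≫ fold X := by
  ext <;> simp [fold]

lemma fold_comm (X : C) : (coprod.braiding X X).hom ≫ fold X = fold X := by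
  ext <;> simp [fold]

lemma swap_fold (X Y : C) : swap X Y X Y ≫ coprod.map (fold X) (fold Y) = fold (X ⨿ Y) := by
  ext <;> simp [fold, swap]

lemma isPushout_fold (X : C) : IsPushout (fold X) (fold X) (𝟙 X) (𝟙 X) := by
  refine isPushout_mk rfl (fun Q a b e ↦ ⟨a, by simp, ?_⟩) (fun Q l l' h _ ↦ by simpa using h)
  simpa [fold] using coprod.inl ≫= e

lemma isPushout_frobenius (X : C) : IsPushout (coprod.map (fold X) (𝟙 X))
    ((coprod.associator X X X).hom ≫ coprod.map (𝟙 X) (fold X)) (fold X) (fold X) := by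
  refine isPushout_mk (by ext <;> simp [fold]) (fun Q a b e ↦ ?_) (fun Q l l' h _ ↦ ?_)
  · have e₁ := (coprod.inl ≫ coprod.inl) ≫= e
    have e₂ := (coprod.inr ≫ coprod.inl) ≫= e
    have e₃ := coprod.inr ≫= e
    simp [fold] at e₁ e₂ e₃
    refine ⟨coprod.inl ≫ a, ?_, ?_⟩ <;> ext <;> simp [fold, e₁, e₃, e₁.symm.trans e₂]
  · simpa [fold] using coprod.inl ≫= h

lemma isPushout_frobenius' (X : C) : IsPushout (coprod.map (𝟙 X) (fold X))
    ((coprod.associator X X X).inv ≫ coprod.map (fold X) (𝟙 X)) (fold X) (fold X) := by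
  refine isPushout_mk (by ext <;> simp [fold]) (fun Q a b e ↦ ?_) (fun Q l l' h _ ↦ ?_)
  · have e₁ := coprod.inl ≫= e
    have e₂ := (coprod.inl ≫ coprod.inr) ≫= e
    have e₃ := (coprod.inr ≫ coprod.inr) ≫= e
    simp [fold] at e₁ e₂ e₃
    refine ⟨coprod.inl ≫ a, ?_, ?_⟩ <;> ext <;> simp [fold, e₁, e₃, e₂.symm.trans e₃]
  · simpa [fold] using coprod.inl ≫= h

namespace DecCospanCat

open Decoration

variable {F : C ⥤ D}

variable [BraidedCategory D] [F.LaxBraided]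

/-- The monoidal product of objects of `F Cospan` is the coproduct in `C`. -/
noncomputable abbrev tensorObj (X Y : DecCospanCat F) : DecCospanCat F := ⟨X.as ⨿ Y.as⟩

/-- The monoidal product of morphisms of `F Cospan`. -/
noncomputable def tensorHom {X Y X' Y' : DecCospanCat F} (f : X ⟶ Y) (g : X' ⟶ Y') :
    tensorObj X X' ⟶ tensorObj Y Y' :=
  Quotient.map₂ DecoratedCospan.tensor (fun _ _ h _ _ k ↦ DecoratedCospan.tensor_congr h k) f g

/-- The associator, the unitors and the braiding of `F Cospan` are the images of those of
`(C, +)`. -/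
noncomputable instance : MonoidalCategoryStruct (DecCospanCat F) where
  tensorObj := tensorObj
  tensorHom := tensorHom
  whiskerLeft X _ _ f := tensorHom (𝟙 X) f
  whiskerRight f Y := tensorHom f (𝟙 Y)
  tensorUnit := ⟨⊥_ C⟩
  associator X Y Z := grIso (coprod.associator X.as Y.as Z.as)
  leftUnitor X := grIso (coprod.leftUnitor X.as)
  rightUnitor X := grIso (coprod.rightUnitor X.as)

lemma tensorHom_homMk {X Y X' Y' : DecCospanCat F} {N N' : C} (i : X.as ⟶ N) (o : Y.as ⟶ N)
    (s : Decoration F N) (i' : X'.as ⟶ N') (o' : Y'.as ⟶ N') (s' : Decoration F N') :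
    (homMk N i o s : X ⟶ Y) ⊗ₘ (homMk N' i' o' s' : X' ⟶ Y') =
      homMk (N ⨿ N') (coprod.map i i') (coprod.map o o')
        (push coprod.inl s * push coprod.inr s') := by
  rw [← tensor_eq]
  rfl

lemma gr_tensor_gr {X Y X' Y' : DecCospanCat F} (f : X.as ⟶ Y.as) (g : X'.as ⟶ Y'.as) :
    gr f ⊗ₘ gr g = (gr (coprod.map f g) : X ⊗ X' ⟶ Y ⊗ Y') := by
  rw [gr_eq, gr_eq, gr_eq, tensorHom_homMk]
  simp only [push_one, mul_one, coprod.map_id_id]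
  rfl

lemma opGr_tensor_opGr {X Y X' Y' : DecCospanCat F} (f : X.as ⟶ Y.as) (g : X'.as ⟶ Y'.as) :
    opGr f ⊗ₘ opGr g = (opGr (coprod.map f g) : Y ⊗ Y' ⟶ X ⊗ X') := by
  rw [opGr_eq, opGr_eq, opGr_eq, tensorHom_homMk]
  simp only [push_one, mul_one, coprod.map_id_id]
  rfl

noncomputable instance (N : C) : CommMonoid (Decoration F N) where
  mul_comm := mul_comm'

lemma tensorHom_comp {X₁ Y₁ Z₁ X₂ Y₂ Z₂ : DecCospanCat F} (f₁ : X₁ ⟶ Y₁) (f₂ : X₂ ⟶ Y₂)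
    (g₁ : Y₁ ⟶ Z₁) (g₂ : Y₂ ⟶ Z₂) : (f₁ ⊗ₘ f₂) ≫ (g₁ ⊗ₘ g₂) = (f₁ ≫ g₁) ⊗ₘ (f₂ ≫ g₂) := by
  obtain ⟨N, i, o, s, rfl⟩ := exists_homMk f₁
  obtain ⟨N', i', o', s', rfl⟩ := exists_homMk f₂
  obtain ⟨M, k, l, t, rfl⟩ := exists_homMk g₁
  obtain ⟨M', k', l', t', rfl⟩ := exists_homMk g₂
  have h := IsPushout.of_hasPushout o k
  have h' := IsPushout.of_hasPushout o' k'
  rw [homMk_comp h, homMk_comp h', tensorHom_homMk, tensorHom_homMk, tensorHom_homMk,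
    homMk_comp (isPushout_coprod h h')]
  simp [mul_mul_mul_comm]

noncomputable instance : MonoidalCategory (DecCospanCat F) := .ofTensorHom
  (id_tensorHom_id := fun X Y ↦ by
    rw [← gr_id, ← gr_id, gr_tensor_gr, coprod.map_id_id]
    rfl)
  (id_tensorHom := fun _ _ _ _ ↦ rfl)
  (tensorHom_id := fun _ _ ↦ rfl)
  (tensorHom_comp_tensorHom := tensorHom_comp)
  (associator_naturality := fun {X₁ X₂ X₃ Y₁ Y₂ Y₃} f₁ f₂ f₃ ↦ by
    obtain ⟨N₁, i₁, o₁, s₁, rfl⟩ := exists_homMk f₁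
    obtain ⟨N₂, i₂, o₂, s₂, rfl⟩ := exists_homMk f₂
    obtain ⟨N₃, i₃, o₃, s₃, rfl⟩ := exists_homMk f₃
    simp only [tensorHom_homMk]
    refine (homMk_comp_gr_iso _ _ _ _).trans (Eq.trans ?_ (gr_comp_homMk _ _ _ _).symm)
    refine homMk_congr (coprod.associator _ _ _) ?_ ?_ ?_
    · exact coprod.associator_naturality _ _ _
    · rw [Category.assoc, coprod.associator_naturality, Iso.inv_hom_id_assoc]
    · simp [mul_assoc])
  (leftUnitor_naturality := fun {X Y} f ↦ by
    obtain ⟨N, i, o, s, rfl⟩ := exists_homMk f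
    rw [id_eq, tensorHom_homMk]
    refine (homMk_comp_gr_iso _ _ _ _).trans (Eq.trans ?_ (gr_comp_homMk _ _ _ _).symm)
    refine homMk_congr (coprod.leftUnitor _) ?_ ?_ ?_
    · exact coprod.leftUnitor_naturality _
    · rw [Category.assoc]
      erw [coprod.leftUnitor_naturality]
      rw [Iso.inv_hom_id_assoc]
    · simp)
  (rightUnitor_naturality := fun {X Y} f ↦ by
    obtain ⟨N, i, o, s, rfl⟩ := exists_homMk f
    rw [id_eq, tensorHom_homMk]
    refine (homMk_comp_gr_iso _ _ _ _).trans (Eq.trans ?_ (gr_comp_homMk _ _ _ _).symm)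
    refine homMk_congr (coprod.rightUnitor _) ?_ ?_ ?_
    · exact coprod.rightUnitor_naturality _
    · rw [Category.assoc]
      erw [coprod.rightUnitor_naturality]
      rw [Iso.inv_hom_id_assoc]
    · simp)
  (pentagon := fun W X Y Z ↦ by
    rw [← gr_id, ← gr_id]
    change (gr _ ⊗ₘ gr _) ≫ gr _ ≫ (gr _ ⊗ₘ gr _) = gr _ ≫ gr _
    erw [gr_tensor_gr, gr_tensor_gr, gr_comp, gr_comp, gr_comp]
    congr 1
    exact coprod.pentagon _ _ _ _)
  (triangle := fun X Y ↦ by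
    rw [← gr_id, ← gr_id]
    change gr _ ≫ (gr _ ⊗ₘ gr _) = gr _ ⊗ₘ gr _
    erw [gr_tensor_gr, gr_tensor_gr, gr_comp]
    congr 1
    exact coprod.triangle _ _)

lemma whiskerLeft_gr (X : DecCospanCat F) {Y Z : DecCospanCat F} (f : Y.as ⟶ Z.as) :
    X ◁ gr f = (gr (coprod.map (𝟙 X.as) f) : X ⊗ Y ⟶ X ⊗ Z) :=
  gr_tensor_gr (𝟙 X.as) f

lemma gr_whiskerRight {Y Z : DecCospanCat F} (f : Y.as ⟶ Z.as) (X : DecCospanCat F) :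
    gr f ▷ X = (gr (coprod.map f (𝟙 X.as)) : Y ⊗ X ⟶ Z ⊗ X) :=
  gr_tensor_gr f (𝟙 X.as)

lemma whiskerLeft_opGr (X : DecCospanCat F) {Y Z : DecCospanCat F} (f : Y.as ⟶ Z.as) :
    X ◁ opGr f = (opGr (coprod.map (𝟙 X.as) f) : X ⊗ Z ⟶ X ⊗ Y) :=
  opGr_tensor_opGr (𝟙 X.as) f

lemma opGr_whiskerRight {Y Z : DecCospanCat F} (f : Y.as ⟶ Z.as) (X : DecCospanCat F) :
    opGr f ▷ X = (opGr (coprod.map f (𝟙 X.as)) : Z ⊗ X ⟶ Y ⊗ X) :=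
  opGr_tensor_opGr f (𝟙 X.as)

lemma associator_hom (X Y Z : DecCospanCat F) :
    (α_ X Y Z).hom = gr (coprod.associator X.as Y.as Z.as).hom := rfl

lemma associator_inv (X Y Z : DecCospanCat F) :
    (α_ X Y Z).inv = gr (coprod.associator X.as Y.as Z.as).inv := rfl

lemma braiding_naturality {X X' Y Y' : DecCospanCat F} (f : X ⟶ Y) (g : X' ⟶ Y') :
    (f ⊗ₘ g) ≫ (gr (coprod.braiding Y.as Y'.as).hom : Y ⊗ Y' ⟶ Y' ⊗ Y) =
      (gr (coprod.braiding X.as X'.as).hom : X ⊗ X' ⟶ X' ⊗ X) ≫ (g ⊗ₘ f) := by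
  obtain ⟨N, i, o, s, rfl⟩ := exists_homMk f
  obtain ⟨N', i', o', s', rfl⟩ := exists_homMk g
  simp only [tensorHom_homMk]
  refine (homMk_comp_gr_iso _ _ _ _).trans (Eq.trans ?_ (gr_comp_homMk _ _ _ _).symm)
  refine homMk_congr (coprod.braiding _ _) ?_ ?_ ?_
  · exact map_braiding _ _
  · exact (Category.assoc _ _ _).trans ((Iso.inv_comp_eq _).2 (map_braiding _ _))
  · simp [mul_comm]

noncomputable instance : SymmetricCategory (DecCospanCat F) where
  braiding X Y := grIso (coprod.braiding X.as Y.as)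
  braiding_naturality_left f Z := braiding_naturality f (𝟙 Z)
  braiding_naturality_right X _ _ f := braiding_naturality (𝟙 X) f
  hexagon_forward X Y Z := by
    simp only [associator_hom, grIso_hom, whiskerLeft_gr, gr_whiskerRight]
    erw [gr_comp, gr_comp, gr_comp, gr_comp]
    exact congrArg gr (BraidedCategory.hexagon_forward X.as Y.as Z.as)
  hexagon_reverse X Y Z := by
    simp only [associator_inv, grIso_hom, whiskerLeft_gr, gr_whiskerRight]
    erw [gr_comp, gr_comp, gr_comp, gr_comp]
    exact congrArg gr (BraidedCategory.hexagon_reverse X.as Y.as Z.as)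
  symmetry X Y := by
    simp only [grIso_hom]
    erw [gr_comp]
    simp
    rfl

lemma braiding_hom (X Y : DecCospanCat F) :
    (β_ X Y).hom = gr (coprod.braiding X.as Y.as).hom := rfl

lemma tensorμ_eq (X Y Z W : DecCospanCat F) :
    tensorμ X Y Z W = gr (swap X.as Y.as Z.as W.as) := by
  simp only [tensorμ, associator_hom, associator_inv, braiding_hom, whiskerLeft_gr,
    gr_whiskerRight]
  erw [gr_comp, gr_comp, gr_comp, gr_comp]
  exact congrArg gr (swap_eq _ _ _ _)

lemma tensorμ_eq' (X Y Z W : DecCospanCat F) :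
    tensorμ X Y Z W = opGr (swap X.as Z.as Y.as W.as) :=
  (tensorμ_eq X Y Z W).trans (opGr_iso_hom (X := (X ⊗ Z) ⊗ (Y ⊗ W)) (Y := (X ⊗ Y) ⊗ (Z ⊗ W))
    (swapIso X.as Z.as Y.as W.as)).symm

lemma associator_hom' (X Y Z : DecCospanCat F) :
    (α_ X Y Z).hom = opGr (coprod.associator X.as Y.as Z.as).inv :=
  (opGr_iso_hom (X := X ⊗ Y ⊗ Z) (Y := (X ⊗ Y) ⊗ Z) (coprod.associator X.as Y.as Z.as).symm).symm

lemma leftUnitor_hom' (X : DecCospanCat F) :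
    (λ_ X).hom = opGr (coprod.leftUnitor X.as).inv :=
  (opGr_iso_hom (X := X) (Y := 𝟙_ _ ⊗ X) (coprod.leftUnitor X.as).symm).symm

lemma leftUnitor_inv' (X : DecCospanCat F) :
    (λ_ X).inv = opGr (coprod.leftUnitor X.as).hom :=
  (opGr_iso_hom (X := 𝟙_ _ ⊗ X) (Y := X) (coprod.leftUnitor X.as)).symm

lemma rightUnitor_inv' (X : DecCospanCat F) :
    (ρ_ X).inv = opGr (coprod.rightUnitor X.as).hom :=
  (opGr_iso_hom (X := X ⊗ 𝟙_ _) (Y := X) (coprod.rightUnitor X.as)).symm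

lemma braiding_hom' (X Y : DecCospanCat F) :
    (β_ X Y).hom = opGr (coprod.braiding Y.as X.as).hom :=
  (opGr_iso_hom (X := Y ⊗ X) (Y := X ⊗ Y) (coprod.braiding Y.as X.as)).symm

/-- The Frobenius structure on an object of `F Cospan`: the fold map and the map from the initial
object, together with their opposites, all empty-decorated. -/
noncomputable def frobenius (X : DecCospanCat F) : SpecialCommFrobenius X where
  mul := (gr (fold X.as) : X ⊗ X ⟶ X)
  one := (gr (initial.to X.as) : 𝟙_ _ ⟶ X)
  comul := (opGr (fold X.as) : X ⟶ X ⊗ X)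
  counit := (opGr (initial.to X.as) : X ⟶ 𝟙_ _)
  one_mul := by
    rw [gr_whiskerRight]
    erw [gr_comp]
    exact congrArg gr (unit_fold _)
  mul_one := by
    rw [whiskerLeft_gr]
    erw [gr_comp]
    exact congrArg gr (fold_unit _)
  mul_assoc := by
    rw [whiskerLeft_gr, gr_whiskerRight, associator_hom]
    erw [gr_comp, gr_comp, gr_comp]
    exact congrArg gr (fold_assoc _)
  counit_comul := by
    rw [opGr_whiskerRight, leftUnitor_inv']
    erw [opGr_comp]
    exact congrArg opGr (unit_fold _)
  comul_counit := by
    rw [whiskerLeft_opGr, rightUnitor_inv']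
    erw [opGr_comp]
    exact congrArg opGr (fold_unit _)
  comul_assoc := by
    rw [whiskerLeft_opGr, opGr_whiskerRight, associator_hom']
    erw [opGr_comp, opGr_comp, opGr_comp]
    exact congrArg opGr ((fold_assoc_inv _).symm.trans (Category.assoc _ _ _).symm)
  mul_comm := by
    rw [braiding_hom]
    erw [gr_comp]
    exact congrArg gr (fold_comm _)
  comul_comm := by
    rw [braiding_hom']
    erw [opGr_comp]
    exact congrArg opGr (fold_comm _)
  frobenius_left := by
    rw [opGr_whiskerRight, associator_hom, whiskerLeft_gr]
    erw [gr_comp, gr_comp_opGr]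
    exact opGr_comp_gr (isPushout_frobenius _)
  frobenius_right := by
    rw [gr_whiskerRight, associator_inv, whiskerLeft_opGr]
    erw [gr_comp, gr_comp_opGr]
    exact opGr_comp_gr (isPushout_frobenius' _)
  special := opGr_comp_gr (isPushout_fold _)

noncomputable instance : HypergraphCategory (DecCospanCat F) where
  frob := frobenius
  mul_tensor X Y := by
    have e : (gr (fold (X.as ⨿ Y.as)) : (X ⊗ Y) ⊗ (X ⊗ Y) ⟶ X ⊗ Y) =
        tensorμ X Y X Y ≫ ((gr (fold X.as) : X ⊗ X ⟶ X) ⊗ₘ (gr (fold Y.as) : Y ⊗ Y ⟶ Y)) := by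
      rw [tensorμ_eq, gr_tensor_gr]
      erw [gr_comp]
      exact congrArg gr (swap_fold _ _).symm
    exact e
  one_tensor X Y := by
    have e : (gr (initial.to (X.as ⨿ Y.as)) : 𝟙_ (DecCospanCat F) ⟶ X ⊗ Y) = (λ_ (𝟙_ _)).inv ≫
        ((gr (initial.to X.as) : 𝟙_ _ ⟶ X) ⊗ₘ (gr (initial.to Y.as) : 𝟙_ _ ⟶ Y)) := by
      rw [gr_tensor_gr]
      erw [gr_comp]
      exact congrArg gr (initialIsInitial.hom_ext _ _)
    exact e
  comul_tensor X Y := by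
    have e : (opGr (fold (X.as ⨿ Y.as)) : X ⊗ Y ⟶ (X ⊗ Y) ⊗ (X ⊗ Y)) =
        ((opGr (fold X.as) : X ⟶ X ⊗ X) ⊗ₘ (opGr (fold Y.as) : Y ⟶ Y ⊗ Y)) ≫
          tensorμ X X Y Y := by
      rw [tensorμ_eq', opGr_tensor_opGr]
      erw [opGr_comp]
      exact congrArg opGr (swap_fold _ _).symm
    exact e
  counit_tensor X Y := by
    have e : (opGr (initial.to (X.as ⨿ Y.as)) : X ⊗ Y ⟶ 𝟙_ (DecCospanCat F)) =
        ((opGr (initial.to X.as) : X ⟶ 𝟙_ _) ⊗ₘ (opGr (initial.to Y.as) : Y ⟶ 𝟙_ _)) ≫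
          (λ_ (𝟙_ _)).hom := by
      rw [leftUnitor_hom', opGr_tensor_opGr]
      erw [opGr_comp]
      exact congrArg opGr (initialIsInitial.hom_ext _ _)
    exact e

end DecCospanCat

end Monoidal

/-! ### The hypergraph category of cospans

The cospan category is built independently of decorations; only the proofs of its axioms are read
off from those of `F Cospan` for `F` the identity functor, by forgetting decorations. -/

section CospanCat

variable {C : Type u} [Category.{v} C]

lemma DecoratedCospan.toCospan_congr {D : Type u₁} [Category.{v₁} D] [MonoidalCategory D]
    {F : C ⥤ D} {X Y : C} {c c' : DecoratedCospan F X Y} (h : c ≈ c') :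
    c.toCospan ≈ c'.toCospan := by
  obtain ⟨n, h₁, h₂, _⟩ := h
  exact ⟨n, h₁, h₂⟩

variable [HasFiniteColimits C]

lemma DecoratedCospan.ofCospan_congr {D : Type u₁} [Category.{v₁} D] [MonoidalCategory D]
    (F : C ⥤ D) [F.LaxMonoidal] {X Y : C} {c c' : Cospan X Y} (h : c ≈ c') :
    ofCospan F c ≈ ofCospan F c' := by
  obtain ⟨n, h₁, h₂⟩ := h
  exact ⟨n, h₁, h₂, Decoration.push_one n.hom⟩

lemma Cospan.comp_congr {X Y Z : C} {c c' : Cospan X Y} {d d' : Cospan Y Z}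
    (h : c ≈ c') (k : d ≈ d') : c.comp d ≈ c'.comp d' :=
  DecoratedCospan.toCospan_congr (DecoratedCospan.comp_congr
    (DecoratedCospan.ofCospan_congr (𝟭 C) h) (DecoratedCospan.ofCospan_congr (𝟭 C) k))

lemma Cospan.tensor_congr {X Y X' Y' : C} {c c' : Cospan X Y} {d d' : Cospan X' Y'}
    (h : c ≈ c') (k : d ≈ d') : c.tensor d ≈ c'.tensor d' :=
  DecoratedCospan.toCospan_congr (DecoratedCospan.tensor_congr
    (DecoratedCospan.ofCospan_congr (𝟭 C) h) (DecoratedCospan.ofCospan_congr (𝟭 C) k))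

/-- The category `Cospan(C)`, with objects the objects of `C`. -/
structure CospanCat (C : Type u) where
  as : C

namespace CospanCat

/-- Morphisms of `Cospan(C)` are isomorphism classes of cospans. -/
noncomputable instance : CategoryStruct.{max u v} (CospanCat C) where
  Hom X Y := Quotient (Cospan.setoid X.as Y.as)
  id X := Quotient.mk _ (.id X.as)
  comp := Quotient.map₂ Cospan.comp fun _ _ h _ _ k ↦ Cospan.comp_congr h k

/-- Forgetting the decoration (an auxiliary map for the proofs of the axioms). -/
noncomputable def forget {X Y : DecCospanCat (𝟭 C)} (f : X ⟶ Y) : (⟨X.as⟩ : CospanCat C) ⟶ ⟨Y.as⟩ :=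
  Quotient.map (fun c ↦ c.toCospan) (fun _ _ h ↦ DecoratedCospan.toCospan_congr h) f

lemma exists_forget {X Y : CospanCat C} (f : X ⟶ Y) :
    ∃ f' : (⟨X.as⟩ : DecCospanCat (𝟭 C)) ⟶ ⟨Y.as⟩, f = forget f' := by
  induction f using Quotient.ind with
  | _ c => exact ⟨Quotient.mk _ (.ofCospan (𝟭 C) c), rfl⟩

lemma forget_comp {X Y Z : DecCospanCat (𝟭 C)} (f : X ⟶ Y) (g : Y ⟶ Z) :
    forget (f ≫ g) = forget f ≫ forget g := by
  induction f using Quotient.ind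
  induction g using Quotient.ind
  rfl

noncomputable instance : Category.{max u v} (CospanCat C) where
  id_comp f := by
    obtain ⟨f, rfl⟩ := exists_forget f
    exact (forget_comp _ _).symm.trans (congrArg forget (Category.id_comp f))
  comp_id f := by
    obtain ⟨f, rfl⟩ := exists_forget f
    exact (forget_comp _ _).symm.trans (congrArg forget (Category.comp_id f))
  assoc f g h := by
    obtain ⟨f, rfl⟩ := exists_forget f
    obtain ⟨g, rfl⟩ := exists_forget g
    obtain ⟨h, rfl⟩ := exists_forget h
    simp only [← forget_comp, Category.assoc]

/-- The wide embedding of `C`, sending `f : X ⟶ Y` to the cospan `X ⟶ Y ⟵ Y` with legs `f` and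
`1`. -/
def gr {X Y : CospanCat C} (f : X.as ⟶ Y.as) : X ⟶ Y := Quotient.mk _ ⟨Y.as, f, 𝟙 _⟩

/-- The opposite of `gr f`. -/
def opGr {X Y : CospanCat C} (f : X.as ⟶ Y.as) : Y ⟶ X := Quotient.mk _ ⟨Y.as, 𝟙 _, f⟩

/-- An isomorphism of `C`, regarded as an isomorphism of `Cospan(C)`. -/
@[simps]
noncomputable def grIso {X Y : CospanCat C} (e : X.as ≅ Y.as) : X ≅ Y where
  hom := gr e.hom
  inv := gr e.inv
  hom_inv_id := (forget_comp _ _).symm.trans (congrArg forget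
    (DecCospanCat.grIso (F := 𝟭 C) (X := ⟨X.as⟩) (Y := ⟨Y.as⟩) e).hom_inv_id)
  inv_hom_id := (forget_comp _ _).symm.trans (congrArg forget
    (DecCospanCat.grIso (F := 𝟭 C) (X := ⟨X.as⟩) (Y := ⟨Y.as⟩) e).inv_hom_id)

/-- The monoidal product of objects of `Cospan(C)` is the coproduct in `C`. -/
noncomputable abbrev tensorObj (X Y : CospanCat C) : CospanCat C := ⟨X.as ⨿ Y.as⟩

/-- The monoidal product of morphisms of `Cospan(C)`. -/
noncomputable def tensorHom {X Y X' Y' : CospanCat C} (f : X ⟶ Y) (g : X' ⟶ Y') :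
    tensorObj X X' ⟶ tensorObj Y Y' :=
  Quotient.map₂ Cospan.tensor (fun _ _ h _ _ k ↦ Cospan.tensor_congr h k) f g

/-- The associator, the unitors and the braiding of `Cospan(C)` are the images of those of
`(C, +)`. -/
noncomputable instance : MonoidalCategoryStruct (CospanCat C) where
  tensorObj := tensorObj
  tensorHom := tensorHom
  whiskerLeft X _ _ f := tensorHom (𝟙 X) f
  whiskerRight f Y := tensorHom f (𝟙 Y)
  tensorUnit := ⟨⊥_ C⟩
  associator X Y Z := grIso (coprod.associator X.as Y.as Z.as)
  leftUnitor X := grIso (coprod.leftUnitor X.as)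
  rightUnitor X := grIso (coprod.rightUnitor X.as)

lemma forget_tensorHom {X Y X' Y' : DecCospanCat (𝟭 C)} (f : X ⟶ Y) (g : X' ⟶ Y') :
    forget (f ⊗ₘ g) = forget f ⊗ₘ forget g := by
  induction f using Quotient.ind
  induction g using Quotient.ind
  rfl

noncomputable instance : MonoidalCategory (CospanCat C) := .ofTensorHom
  (id_tensorHom_id := fun X Y ↦ congrArg forget (MonoidalCategory.id_tensorHom_id
    (⟨X.as⟩ : DecCospanCat (𝟭 C)) ⟨Y.as⟩))
  (id_tensorHom := fun _ _ _ _ ↦ rfl)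
  (tensorHom_id := fun _ _ ↦ rfl)
  (tensorHom_comp_tensorHom := fun f₁ f₂ g₁ g₂ ↦ by
    obtain ⟨f₁, rfl⟩ := exists_forget f₁
    obtain ⟨f₂, rfl⟩ := exists_forget f₂
    obtain ⟨g₁, rfl⟩ := exists_forget g₁
    obtain ⟨g₂, rfl⟩ := exists_forget g₂
    simp only [← forget_comp, ← forget_tensorHom]
    exact congrArg forget (MonoidalCategory.tensorHom_comp_tensorHom f₁ f₂ g₁ g₂))
  (associator_naturality := fun f₁ f₂ f₃ ↦ by
    obtain ⟨f₁, rfl⟩ := exists_forget f₁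
    obtain ⟨f₂, rfl⟩ := exists_forget f₂
    obtain ⟨f₃, rfl⟩ := exists_forget f₃
    simp only [← forget_tensorHom]
    exact (forget_comp _ (α_ _ _ _).hom).symm.trans ((congrArg forget
      (MonoidalCategory.associator_naturality f₁ f₂ f₃)).trans (forget_comp (α_ _ _ _).hom _)))
  (leftUnitor_naturality := fun f ↦ by
    obtain ⟨f, rfl⟩ := exists_forget f
    refine Eq.trans ?_ ((congrArg forget (MonoidalCategory.leftUnitor_naturality f)).trans
      (forget_comp (λ_ _).hom _))
    rw [forget_comp, ← MonoidalCategory.id_tensorHom, forget_tensorHom]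
    rfl)
  (rightUnitor_naturality := fun f ↦ by
    obtain ⟨f, rfl⟩ := exists_forget f
    refine Eq.trans ?_ ((congrArg forget (MonoidalCategory.rightUnitor_naturality f)).trans
      (forget_comp (ρ_ _).hom _))
    rw [forget_comp, ← MonoidalCategory.tensorHom_id, forget_tensorHom]
    rfl)
  (pentagon := fun W X Y Z ↦ congrArg forget (MonoidalCategory.pentagon
    (⟨W.as⟩ : DecCospanCat (𝟭 C)) ⟨X.as⟩ ⟨Y.as⟩ ⟨Z.as⟩))
  (triangle := fun X Y ↦ congrArg forget (MonoidalCategory.triangle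
    (⟨X.as⟩ : DecCospanCat (𝟭 C)) ⟨Y.as⟩))

lemma braiding_naturality {X X' Y Y' : CospanCat C} (f : X ⟶ Y) (g : X' ⟶ Y') :
    (f ⊗ₘ g) ≫ (gr (coprod.braiding Y.as Y'.as).hom : Y ⊗ Y' ⟶ Y' ⊗ Y) =
      (gr (coprod.braiding X.as X'.as).hom : X ⊗ X' ⟶ X' ⊗ X) ≫ (g ⊗ₘ f) := by
  obtain ⟨f, rfl⟩ := exists_forget f
  obtain ⟨g, rfl⟩ := exists_forget g
  simp only [← forget_tensorHom]
  exact (forget_comp _ (β_ _ _).hom).symm.trans ((congrArg forget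
    (BraidedCategory.braiding_naturality f g)).trans (forget_comp (β_ _ _).hom _))

noncomputable instance : SymmetricCategory (CospanCat C) where
  braiding X Y := grIso (coprod.braiding X.as Y.as)
  braiding_naturality_left f Z := braiding_naturality f (𝟙 Z)
  braiding_naturality_right X _ _ f := braiding_naturality (𝟙 X) f
  hexagon_forward X Y Z := congrArg forget (BraidedCategory.hexagon_forward
    (⟨X.as⟩ : DecCospanCat (𝟭 C)) ⟨Y.as⟩ ⟨Z.as⟩)
  hexagon_reverse X Y Z := congrArg forget (BraidedCategory.hexagon_reverse
    (⟨X.as⟩ : DecCospanCat (𝟭 C)) ⟨Y.as⟩ ⟨Z.as⟩)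
  symmetry X Y := congrArg forget (SymmetricCategory.symmetry
    (⟨X.as⟩ : DecCospanCat (𝟭 C)) ⟨Y.as⟩)

/-- The Frobenius structure on an object of `Cospan(C)`: the fold map and the map from the initial
object, together with their opposites. -/
noncomputable def frobenius (X : CospanCat C) : SpecialCommFrobenius X where
  mul := (gr (fold X.as) : X ⊗ X ⟶ X)
  one := (gr (initial.to X.as) : 𝟙_ _ ⟶ X)
  comul := (opGr (fold X.as) : X ⟶ X ⊗ X)
  counit := (opGr (initial.to X.as) : X ⟶ 𝟙_ _)
  one_mul := congrArg forget (DecCospanCat.frobenius (F := 𝟭 C) ⟨X.as⟩).one_mul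
  mul_one := congrArg forget (DecCospanCat.frobenius (F := 𝟭 C) ⟨X.as⟩).mul_one
  mul_assoc := congrArg forget (DecCospanCat.frobenius (F := 𝟭 C) ⟨X.as⟩).mul_assoc
  counit_comul := congrArg forget (DecCospanCat.frobenius (F := 𝟭 C) ⟨X.as⟩).counit_comul
  comul_counit := congrArg forget (DecCospanCat.frobenius (F := 𝟭 C) ⟨X.as⟩).comul_counit
  comul_assoc := congrArg forget (DecCospanCat.frobenius (F := 𝟭 C) ⟨X.as⟩).comul_assoc
  mul_comm := congrArg forget (DecCospanCat.frobenius (F := 𝟭 C) ⟨X.as⟩).mul_comm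
  comul_comm := congrArg forget (DecCospanCat.frobenius (F := 𝟭 C) ⟨X.as⟩).comul_comm
  frobenius_left := congrArg forget (DecCospanCat.frobenius (F := 𝟭 C) ⟨X.as⟩).frobenius_left
  frobenius_right := congrArg forget (DecCospanCat.frobenius (F := 𝟭 C) ⟨X.as⟩).frobenius_right
  special := congrArg forget (DecCospanCat.frobenius (F := 𝟭 C) ⟨X.as⟩).special

noncomputable instance : HypergraphCategory (CospanCat C) where
  frob := frobenius
  mul_tensor X Y := congrArg forget (HypergraphCategory.mul_tensor
    (⟨X.as⟩ : DecCospanCat (𝟭 C)) ⟨Y.as⟩)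
  one_tensor X Y := congrArg forget (HypergraphCategory.one_tensor
    (⟨X.as⟩ : DecCospanCat (𝟭 C)) ⟨Y.as⟩)
  comul_tensor X Y := congrArg forget (HypergraphCategory.comul_tensor
    (⟨X.as⟩ : DecCospanCat (𝟭 C)) ⟨Y.as⟩)
  counit_tensor X Y := congrArg forget (HypergraphCategory.counit_tensor
    (⟨X.as⟩ : DecCospanCat (𝟭 C)) ⟨Y.as⟩)

end CospanCat

/-- The embedding `Cospan(C) ⥤ F Cospan`: the identity on objects, and equipping each cospan with
the empty decoration on its apex. -/
noncomputable def emptyDecorated {D : Type u₁} [Category.{v₁} D] [MonoidalCategory D]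
    [BraidedCategory D] (F : C ⥤ D) [F.LaxBraided] : CospanCat C ⥤ DecCospanCat F where
  obj X := ⟨X.as⟩
  map := Quotient.map (DecoratedCospan.ofCospan F)
    (fun _ _ h ↦ DecoratedCospan.ofCospan_congr F h)
  map_id _ := rfl
  map_comp f g := by
    induction f using Quotient.ind with
    | _ c =>
    induction g using Quotient.ind with
    | _ d =>
    refine Quotient.sound ⟨Iso.refl _, Category.comp_id _, Category.comp_id _, ?_⟩
    have e : Decoration.empty F _ = Decoration.push (coprod.desc (pushout.inl c.o d.i)
        (pushout.inr c.o d.i)) ((Decoration.empty F c.apex).tensor (Decoration.empty F d.apex)) := by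
      rw [Decoration.push_desc_tensor]
      simp only [Decoration.empty_eq, Decoration.push_one, mul_one]
    exact (Decoration.push_id _).trans e

end CospanCat

end Fcospan

/-!
The monoidal unit of `(C, +)` is the initial object, so a decoration `1 ⟶ 1_C N = N` is a map out of
an initial object, and hence unique: it is the empty one (`Decoration.eq_empty`). Consequently
forgetting decorations and equipping cospans with empty decorations are mutually inverse on
isomorphism classes (`emptyDecorated_comp_forgetDecoration`, `forgetDecoration_comp_emptyDecorated`).

Both functors are the identity on objects, and both hypergraph categories take their monoidal
product from the coproduct of `C`, so both functors are strict monoidal: all coherence maps are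
identities. The only point that needs an argument is that they preserve the monoidal product of
morphisms, which for `emptyDecorated` says that the product of two empty decorations is empty
(`emptyDecorated_map_tensorHom`). The braidings and the Frobenius structures are given on both sides
by the same cospans, on the decorated side with empty decorations, so they correspond as well. The
coherence maps being identities, the composites of the two hypergraph functors are the identities
also as monoidal functors, by the extensionality lemma `HypergraphFunctor.ext_of_eq`.
-/

namespace Fcospan

open HypergraphCategory Functor.LaxMonoidal Functor.OplaxMonoidal

/-- Hypergraph functors are equal if their underlying functors are equal and their coherence maps
agree modulo the resulting equalities of objects. -/
lemma HypergraphFunctor.ext_of_eq {H : Type u} [Category.{v} H] [MonoidalCategory H]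
    [SymmetricCategory H] [HypergraphCategory H] {K : Type u₁} [Category.{v₁} K]
    [MonoidalCategory K] [SymmetricCategory K] [HypergraphCategory K]
    (S T : HypergraphFunctor H K) (h : S.toFunctor = T.toFunctor)
    (hε : ε S.toFunctor ≫ eqToHom (by rw [h]) = ε T.toFunctor)
    (hμ : ∀ X Y, μ S.toFunctor X Y ≫ eqToHom (by rw [h]) =
      eqToHom (by rw [h]) ≫ μ T.toFunctor X Y) : S = T := by
  obtain ⟨S, b, _, _, _, _⟩ := S
  obtain ⟨T, b', _, _, _, _⟩ := T
  dsimp only at h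
  subst h
  refine mk_congr S b b' _ _ _ _ _ _ _ _ ?_ ?_
  · simpa only [eqToHom_refl, Category.comp_id] using hε
  · funext X Y
    simpa only [eqToHom_refl, Category.comp_id, Category.id_comp] using hμ X Y

variable {C : Type u} [Category.{v} C] [HasFiniteColimits C]

/-- Here `𝟙_ C` is by definition the initial object of `C`. -/
lemma Decoration.eq_empty {N : C} (s : Decoration (𝟭 C) N) : s = empty (𝟭 C) N :=
  initialIsInitial.hom_ext _ _

section EmptyDecorated

variable {D : Type u₁} [Category.{v₁} D] [MonoidalCategory D] [BraidedCategory D] (F : C ⥤ D)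
  [F.LaxBraided]

/-- The product of two empty decorations is the empty decoration of the coproduct. -/
lemma emptyDecorated_map_tensorHom {X Y X' Y' : CospanCat C} (f : X ⟶ Y) (g : X' ⟶ Y') :
    (emptyDecorated F).map (f ⊗ₘ g) =
      (emptyDecorated F).map f ⊗ₘ (emptyDecorated F).map g := by
  induction f using Quotient.ind with
  | _ c =>
  induction g using Quotient.ind with
  | _ d =>
  refine Quotient.sound ⟨Iso.refl _, Category.comp_id _, Category.comp_id _, ?_⟩
  have e : Decoration.empty F (c.apex ⨿ d.apex) =
      (Decoration.empty F c.apex).tensor (Decoration.empty F d.apex) := by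
    rw [Decoration.tensor_eq]
    simp only [Decoration.empty_eq, Decoration.push_one, mul_one]
  exact (Decoration.push_id _).trans e

/-- The strict monoidal structure on `emptyDecorated F`. The source and the target of each coherence
map are definitionally equal, so identities can serve as coherence isomorphisms. -/
noncomputable def emptyDecoratedCore : (emptyDecorated F).CoreMonoidal where
  εIso := Iso.refl (𝟙_ (DecCospanCat F))
  μIso X Y := Iso.refl ((⟨X.as⟩ : DecCospanCat F) ⊗ ⟨Y.as⟩)
  μIso_hom_natural_left f X' :=
    (Category.comp_id _).trans ((emptyDecorated_map_tensorHom F f (𝟙 X')).symm.trans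
      (Category.id_comp _).symm)
  μIso_hom_natural_right X' f :=
    (Category.comp_id _).trans ((emptyDecorated_map_tensorHom F (𝟙 X') f).symm.trans
      (Category.id_comp _).symm)
  associativity X Y Z :=
    let A (X : CospanCat C) : DecCospanCat F := ⟨X.as⟩
    (by simp : 𝟙 (A X ⊗ A Y) ▷ A Z ≫ 𝟙 _ ≫ (α_ (A X) (A Y) (A Z)).hom =
      (α_ _ _ _).hom ≫ A X ◁ 𝟙 (A Y ⊗ A Z) ≫ 𝟙 _)
  left_unitality X :=
    (by simp : (λ_ (⟨X.as⟩ : DecCospanCat F)).hom = 𝟙 (𝟙_ _) ▷ _ ≫ 𝟙 _ ≫ (λ_ _).hom)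
  right_unitality X :=
    (by simp : (ρ_ (⟨X.as⟩ : DecCospanCat F)).hom = _ ◁ 𝟙 (𝟙_ _) ≫ 𝟙 _ ≫ (ρ_ _).hom)

/-- The embedding `Cospan(C) ⥤ F Cospan` as a hypergraph functor. -/
noncomputable def emptyDecoratedHypergraph :
    HypergraphFunctor (CospanCat C) (DecCospanCat F) where
  toFunctor := emptyDecorated F
  braided :=
    { toMonoidal := (emptyDecoratedCore F).toMonoidal
      braided := fun X Y ↦
        (Category.id_comp (β_ (⟨X.as⟩ : DecCospanCat F) ⟨Y.as⟩).hom).trans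
          (Category.comp_id _).symm }
  map_mul X := (Category.id_comp (frob (⟨X.as⟩ : DecCospanCat F)).mul).symm
  map_one X := (Category.id_comp (frob (⟨X.as⟩ : DecCospanCat F)).one).symm
  map_comul X := (Category.comp_id (frob (⟨X.as⟩ : DecCospanCat F)).comul).symm
  map_counit X := (Category.comp_id (frob (⟨X.as⟩ : DecCospanCat F)).counit).symm

end EmptyDecorated

section Forget

variable (C)

/-- The functor `1_C Cospan ⥤ Cospan(C)` forgetting decorations. -/
noncomputable def forgetDecoration : DecCospanCat (𝟭 C) ⥤ CospanCat C where
  obj X := ⟨X.as⟩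
  map f := CospanCat.forget f
  map_id _ := rfl
  map_comp := CospanCat.forget_comp

/-- The strict monoidal structure on `forgetDecoration C`, with identities as coherence maps. -/
noncomputable def forgetDecorationCore : (forgetDecoration C).CoreMonoidal where
  εIso := Iso.refl (𝟙_ (CospanCat C))
  μIso X Y := Iso.refl ((⟨X.as⟩ : CospanCat C) ⊗ ⟨Y.as⟩)
  μIso_hom_natural_left f X' :=
    (Category.comp_id _).trans ((CospanCat.forget_tensorHom f (𝟙 X')).symm.trans
      (Category.id_comp _).symm)
  μIso_hom_natural_right X' f :=
    (Category.comp_id _).trans ((CospanCat.forget_tensorHom (𝟙 X') f).symm.trans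
      (Category.id_comp _).symm)
  associativity X Y Z :=
    let A (X : DecCospanCat (𝟭 C)) : CospanCat C := ⟨X.as⟩
    (by simp : 𝟙 (A X ⊗ A Y) ▷ A Z ≫ 𝟙 _ ≫ (α_ (A X) (A Y) (A Z)).hom =
      (α_ _ _ _).hom ≫ A X ◁ 𝟙 (A Y ⊗ A Z) ≫ 𝟙 _)
  left_unitality X :=
    (by simp : (λ_ (⟨X.as⟩ : CospanCat C)).hom = 𝟙 (𝟙_ _) ▷ _ ≫ 𝟙 _ ≫ (λ_ _).hom)
  right_unitality X :=
    (by simp : (ρ_ (⟨X.as⟩ : CospanCat C)).hom = _ ◁ 𝟙 (𝟙_ _) ≫ 𝟙 _ ≫ (ρ_ _).hom)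

/-- The functor forgetting decorations as a hypergraph functor. -/
noncomputable def forgetDecorationHypergraph :
    HypergraphFunctor (DecCospanCat (𝟭 C)) (CospanCat C) where
  toFunctor := forgetDecoration C
  braided :=
    { toMonoidal := (forgetDecorationCore C).toMonoidal
      braided := fun X Y ↦
        (Category.id_comp (β_ (⟨X.as⟩ : CospanCat C) ⟨Y.as⟩).hom).trans
          (Category.comp_id _).symm }
  map_mul X := (Category.id_comp (frob (⟨X.as⟩ : CospanCat C)).mul).symm
  map_one X := (Category.id_comp (frob (⟨X.as⟩ : CospanCat C)).one).symm
  map_comul X := (Category.comp_id (frob (⟨X.as⟩ : CospanCat C)).comul).symm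
  map_counit X := (Category.comp_id (frob (⟨X.as⟩ : CospanCat C)).counit).symm

end Forget

variable (C)

lemma emptyDecorated_comp_forgetDecoration :
    emptyDecorated (𝟭 C) ⋙ forgetDecoration C = 𝟭 (CospanCat C) := by
  refine CategoryTheory.Functor.hext (fun _ ↦ rfl) fun _ _ f ↦ heq_of_eq ?_
  induction f using Quotient.ind
  rfl

lemma forgetDecoration_comp_emptyDecorated :
    forgetDecoration C ⋙ emptyDecorated (𝟭 C) = 𝟭 (DecCospanCat (𝟭 C)) := by
  refine CategoryTheory.Functor.hext (fun _ ↦ rfl) fun _ _ f ↦ heq_of_eq ?_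
  induction f using Quotient.ind with
  | _ c =>
  exact Quotient.sound ⟨Iso.refl _, Category.comp_id _, Category.comp_id _,
    (Decoration.eq_empty _).trans (Decoration.eq_empty _).symm⟩

/-- The isomorphism of hypergraph categories between `Cospan(C)` and `1_C Cospan`. -/
noncomputable def cospanIso : HypergraphCat.mk (CospanCat C) ≅
    HypergraphCat.mk (DecCospanCat (𝟭 C)) where
  hom := emptyDecoratedHypergraph (𝟭 C)
  inv := forgetDecorationHypergraph C
  hom_inv_id := by
    refine HypergraphFunctor.ext_of_eq
      ((emptyDecoratedHypergraph (𝟭 C)).comp (forgetDecorationHypergraph C))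
      (HypergraphFunctor.id _) (emptyDecorated_comp_forgetDecoration C) ?_ fun X Y ↦ ?_
    · change (𝟙 (𝟙_ (CospanCat C)) ≫ 𝟙 _) ≫ 𝟙 _ = 𝟙 _
      simp only [Category.comp_id]
    · change (𝟙 (X ⊗ Y) ≫ 𝟙 _) ≫ 𝟙 _ = 𝟙 _ ≫ 𝟙 _
      simp only [Category.comp_id]
  inv_hom_id := by
    refine HypergraphFunctor.ext_of_eq
      ((forgetDecorationHypergraph C).comp (emptyDecoratedHypergraph (𝟭 C)))
      (HypergraphFunctor.id _) (forgetDecoration_comp_emptyDecorated C) ?_ fun X Y ↦ ?_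
    · change (𝟙 (𝟙_ (DecCospanCat (𝟭 C))) ≫ 𝟙 _) ≫ 𝟙 _ = 𝟙 _
      simp only [Category.comp_id]
    · change (𝟙 (X ⊗ Y) ≫ 𝟙 _) ≫ 𝟙 _ = 𝟙 _ ≫ 𝟙 _
      simp only [Category.comp_id]

end Fcospan

theorem corollary3p4 (C : Type u) [Category.{v} C] [HasFiniteColimits C] :
    (∀ (N : C) (s : Fcospan.Decoration (𝟭 C) N), s = Fcospan.Decoration.empty (𝟭 C) N) ∧
    ∃ e : Fcospan.HypergraphCat.mk (Fcospan.CospanCat C) ≅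
        Fcospan.HypergraphCat.mk (Fcospan.DecCospanCat (𝟭 C)),
      e.hom.toFunctor = Fcospan.emptyDecorated (𝟭 C) :=
  ⟨fun _ s ↦ s.eq_empty, Fcospan.cospanIso C, rfl⟩
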